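/- Let $d\ge 1$ and let $\mathbb F_d^+$ be the free monoid of words in the letters $1,\dots,d$, with empty word $\emptyset$, length $|\cdot|$ and the shortlex ordering $\prec$ (shorter words come first, words of equal length are compared lexicographically). Write $\sigma-1$ for the immediate predecessor of $\sigma\ne\emptyset$, and $\sigma(n)=d\cdots d$ for the last word of length $n$. Let $L=(L_1,\dots,L_d)$ be the left free shift on $\mathbb H^2_d\cong\ell^2(\mathbb F_d^+)$, $L_je_\sigma=e_{j\sigma}$, let $\mathcal A_d$ be the norm-closed unital algebra generated by $L_1,\dots,L_d$, and let $\mathscr A_d=\overline{\mathcal A_d+\mathcal A_d^*}^{\|\cdot\|}$. An nc measure $\mu$ is a positive linear functional on $\mathscr A_d$. It is a probability nc measure if $\mu(I)=1$, and it is non-trivial if, with $K_\mu(\sigma,\tau)=\mu((L^\tau)^*L^\sigma)$, the matrix $[K_\mu(\sigma,\tau)]_{\sigma,\tau\preceq\sigma_0}$ is invertible for every $\sigma_0\in\mathbb F_d^+$. Let $\mu$ be a non-trivial probability nc measure. Let $(\varphi_\sigma)_{\sigma\in\mathbb F_d^+}$ be the orthonormal polynomials obtained by applying Gram--Schmidt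 to the monomials $Z^\sigma\in\mathbb C\langle Z_1,\dots,Z_d\rangle$, in shortlex order, for the inner product $\langle P,Q\rangle_\mu=\mu(Q(L)^*P(L))$. **Reverse polynomials.** There is exactly one pair of families consisting of complex numbers $(\gamma_\sigma)_{\sigma\in\mathbb F_d^+}$ with $\gamma_\emptyset=0$ and $|\gamma_\sigma|<1$ (the Verblunsky coefficients), and nc polynomials $(\varphi^\#_\sigma)_{\sigma\in\mathbb F_d^+}$ with $\varphi^\#_\emptyset=1$ (the reverse polynomials), such that for all letters $k$ and words $\sigma$ $$\varphi_{k\sigma}=\frac{Z_k\varphi_\sigma-\gamma_{k\sigma}\varphi^\#_{k\sigma-1}}{\sqrt{1-|\gamma_{k\sigma}|^2}},\qquad \varphi^\#_{k\sigma}=\frac{-\overline{\gamma_{k\sigma}}\,Z_k\varphi_\sigma+\varphi^\#_{k\sigma-1}}{\sqrt{1-|\gamma_{k\sigma}|^2}};$$ it is given recursively by $\gamma_{k\sigma}=\langle Z_k\varphi_\sigma,\varphi^\#_{k\sigma-1}\rangle_\mu$ and the second formula. **Theorem (nc Zeros Theorem).** For every $n\in\mathbb N$ (including $0$), every matrix size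 $m$ and every $Z=(Z_1,\dots,Z_d)\in(\mathbb C^{m\times m})^d$, with $Z^*=(Z_1^*,\dots,Z_d^*)$: (i) if $Z_1Z_1^*+\cdots+Z_dZ_d^*<I$ (that is, $Z$ is in the row-ball), then $\varphi^\#_{\sigma(n)}(Z^*)^*\varphi^\#_{\sigma(n)}(Z^*)$ is nonsingular; (ii) if $Z_1Z_1^*+\cdots+Z_dZ_d^*>I$, then $\sum_{|\sigma|=n}\varphi_\sigma(Z^*)^*\varphi_\sigma(Z^*)$ is nonsingular; (iii) if $Z_1Z_1^*+\cdots+Z_dZ_d^*=I$ (that is, $Z$ is a row co-isometry), then both matrices are nonsingular and $$\varphi^\#_{\sigma(n)}(Z^*)^*\varphi^\#_{\sigma(n)}(Z^*)=\sum_{|\sigma|=n}\varphi_\sigma(Z^*)^*\varphi_\sigma(Z^*).$$ Here $A<B$ means that $B-A$ is positive definite. -/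

import Mathlib

open scoped ComplexOrder

noncomputable section

namespace NCZeros

/-! ### Words and the short lexicographical ordering -/

/-- The elements of the free monoid on `d` generators: words in the letters `0, …, d - 1`. They are
lists of letters, in a type of their own because words carry the shortlex ordering instead of the
lexicographic ordering of lists. -/
inductive Word (d : ℕ) : Type
  /-- The empty word. -/
  | empty : Word d
  /-- The word `kσ`. -/
  | cons (k : Fin d) (σ : Word d) : Word d

namespace Word

variable {d : ℕ}

/-- The list of letters of a word. -/
def letters : Word d → List (Fin d)
  | empty => []
  | cons k σ => k :: letters σ

/-- The word with a given list of letters. -/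
def ofLetters : List (Fin d) → Word d
  | [] => empty
  | k :: l => cons k (ofLetters l)

theorem ofLetters_letters (σ : Word d) : ofLetters σ.letters = σ := by
  induction σ with
  | empty => rfl
  | cons k σ ih => exact congrArg (cons k) ih

theorem letters_ofLetters (l : List (Fin d)) : (ofLetters l).letters = l := by
  induction l with
  | nil => rfl
  | cons k l ih => exact congrArg (List.cons k) ih

theorem letters_injective : Function.Injective (letters (d := d)) :=
  Function.LeftInverse.injective ofLetters_letters

/-- The length of a word. -/
def length (σ : Word d) : ℕ := σ.letters.length

/-- The strict short lexicographical ordering: shorter words come first, and words of the same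
length are compared lexicographically. -/
def ShortlexLT (σ τ : Word d) : Prop :=
  List.Shortlex (· < ·) σ.letters τ.letters

instance : IsStrictTotalOrder (Word d) ShortlexLT where
  irrefl := fun a h => asymm (r := List.Shortlex (α := Fin d) (· < ·)) h h
  trichotomous := fun _ _ h h' =>
    letters_injective ((List.Shortlex.trichotomous (r := (· < ·))).trichotomous _ _ h h')
  trans := by
    intro a b c hab hbc
    rcases List.shortlex_def.mp hab with h | ⟨h, h'⟩ <;>
    rcases List.shortlex_def.mp hbc with g | ⟨g, g'⟩
    · exact List.shortlex_def.mpr (Or.inl (h.trans g))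
    · exact List.shortlex_def.mpr (Or.inl (g ▸ h))
    · exact List.shortlex_def.mpr (Or.inl (h ▸ g))
    · exact List.shortlex_def.mpr (Or.inr ⟨h.trans g, List.lt_trans h' g'⟩)

/-- Words are ordered by the short lexicographical ordering. -/
instance : LinearOrder (Word d) :=
  haveI : DecidableRel (ShortlexLT (d := d)) := Classical.decRel _
  linearOrderOfSTO ShortlexLT

theorem lt_iff (σ τ : Word d) :
    σ < τ ↔ σ.length < τ.length ∨
      σ.length = τ.length ∧ List.Lex (· < ·) σ.letters τ.letters :=
  List.shortlex_def

instance : WellFoundedLT (Word d) :=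
  ⟨InvImage.wf letters (List.Shortlex.wf wellFounded_lt)⟩

instance : WellFoundedRelation (Word d) := ⟨(· < ·), wellFounded_lt⟩

theorem length_le_of_le {σ τ : Word d} (h : σ ≤ τ) : σ.length ≤ τ.length := by
  rcases h.lt_or_eq with h | h
  · rcases (lt_iff σ τ).mp h with h | h
    · exact h.le
    · exact h.1.le
  · rw [h]

theorem finite_Iic (σ : Word d) : (Set.Iic σ).Finite :=
  ((List.finite_length_le (Fin d) σ.length).preimage letters_injective.injOn).subset
    fun _ h => length_le_of_le h

/-- Every word has only finitely many predecessors in the shortlex ordering. -/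
instance : LocallyFiniteOrderBot (Word d) :=
  LocallyFiniteOrderBot.ofIic (Word d) (fun σ => (finite_Iic σ).toFinset) (by simp)

theorem empty_lt_cons (k : Fin d) (σ : Word d) : empty < cons k σ :=
  (lt_iff _ _).mpr (Or.inl (Nat.succ_pos _))

/-- The immediate predecessor `kσ - 1` of `kσ` in the shortlex ordering. -/
def predCons (k : Fin d) (σ : Word d) : Word d :=
  (Finset.Iio (cons k σ)).max' ⟨empty, Finset.mem_Iio.mpr (empty_lt_cons k σ)⟩

theorem predCons_lt (k : Fin d) (σ : Word d) : predCons k σ < cons k σ :=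
  Finset.mem_Iio.mp (Finset.max'_mem _ _)

variable (d)

/-- The words of length `n`. -/
def ofLength (n : ℕ) : Finset (Word d) :=
  ((List.finite_length_eq (Fin d) n).preimage letters_injective.injOn).toFinset

/-- The shortlex-final word `σ(n)` of length `n`: the last letter repeated `n` times. -/
def final [NeZero d] (n : ℕ) : Word d :=
  ofLetters (List.replicate n ⟨d - 1, Nat.sub_one_lt (NeZero.ne d)⟩)

end Word

/-! ### The left free shift and nc measures -/

variable {d : ℕ}

/-- The nc Hardy space (full Fock space) `ℍ²_d`: square-summable families of coefficients indexed
by words. -/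
abbrev Fock (d : ℕ) : Type := lp (fun _ : Word d => ℂ) 2

/-- The coefficients of `Z_j f`. -/
def shiftCoeff (j : Fin d) (f : Word d → ℂ) (σ : Word d) : ℂ :=
  match σ with
  | .empty => 0
  | .cons i τ => if i = j then f τ else 0

theorem shiftCoeff_cons (i j : Fin d) (f : Word d → ℂ) (τ : Word d) :
    shiftCoeff j f (Word.cons i τ) = if i = j then f τ else 0 := rfl

theorem cons_injective (j : Fin d) : Function.Injective (Word.cons j) :=
  fun _ _ h => (Word.cons.inj h).2

theorem shiftCoeff_eq_zero (j : Fin d) (f : Word d → ℂ) (σ : Word d)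
    (h : σ ∉ Set.range (Word.cons j)) : shiftCoeff j f σ = 0 := by
  rcases σ with _ | ⟨i, τ⟩
  · rfl
  · change (if i = j then f τ else 0) = 0
    rw [if_neg]
    rintro rfl
    exact h ⟨τ, rfl⟩

theorem hasSum_shiftCoeff (j : Fin d) (f : Fock d) :
    HasSum (fun σ => ‖shiftCoeff j f σ‖ ^ (2 : ENNReal).toReal)
      (‖f‖ ^ (2 : ENNReal).toReal) := by
  have h := lp.hasSum_norm (p := 2) (by norm_num) f
  rw [← (cons_injective j).hasSum_iff]
  · simpa [Function.comp_def, shiftCoeff_cons] using h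
  · intro σ hσ
    simp [shiftCoeff_eq_zero j f σ hσ]

/-- The left shift operator `L_j f = Z_j f` on the nc Hardy space, as an isometry. -/
def leftShiftIsometry (j : Fin d) : Fock d →ₗᵢ[ℂ] Fock d where
  toFun f := ⟨shiftCoeff j f, memℓp_gen (hasSum_shiftCoeff j f).summable⟩
  map_add' f g := by
    ext σ
    rcases σ with _ | ⟨i, τ⟩
    · exact (add_zero (0 : ℂ)).symm
    · change (if i = j then f τ + g τ else 0) =
        (if i = j then f τ else 0) + (if i = j then g τ else 0)
      split_ifs <;> simp
  map_smul' c f := by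
    ext σ
    rcases σ with _ | ⟨i, τ⟩
    · exact (mul_zero c).symm
    · change (if i = j then c * f τ else 0) = c * (if i = j then f τ else 0)
      split_ifs <;> simp
  norm_map' f := by
    have h := lp.hasSum_norm (p := 2) (by norm_num)
      (⟨shiftCoeff j f, memℓp_gen (hasSum_shiftCoeff j f).summable⟩ : Fock d)
    have h2 := h.unique (hasSum_shiftCoeff j f)
    exact (Real.rpow_left_inj (norm_nonneg _) (norm_nonneg _) (by norm_num)).mp h2

/-- The left shift operator `L_j` as a bounded operator. -/
def leftShift (j : Fin d) : Fock d →L[ℂ] Fock d :=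
  (leftShiftIsometry j).toContinuousLinearMap

theorem leftShift_apply (j : Fin d) (f : Fock d) (σ : Word d) :
    leftShift j f σ = shiftCoeff j f σ := rfl

theorem star_leftShift_mul_leftShift (j k : Fin d) :
    star (leftShift j) * leftShift k = if j = k then (1 : Fock d →L[ℂ] Fock d) else 0 := by
  ext1 f
  refine ext_inner_left ℂ fun g => ?_
  rw [mul_apply_eq_comp, ContinuousLinearMap.star_eq_adjoint,
    ContinuousLinearMap.adjoint_inner_right]
  split_ifs with h
  · subst h
    exact (leftShiftIsometry j).inner_map_map g f
  · rw [lp.inner_eq_tsum]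
    simp only [zero_apply, inner_zero_right]
    convert tsum_zero with σ
    rcases σ with _ | ⟨i, τ⟩
    · exact inner_zero_left _
    · change inner ℂ (if i = j then g τ else 0) (if i = k then f τ else 0) = 0
      split_ifs with h1 h2
      · exact absurd (h1.symm.trans h2) h
      all_goals simp

/-- The nc polynomials `ℂ⟨Z_0, …, Z_{d-1}⟩`. -/
abbrev NCPoly (d : ℕ) : Type := FreeAlgebra ℂ (Fin d)

/-- Evaluation of an nc polynomial at a tuple of elements of a complex algebra. -/
def evalAt {A : Type*} [Semiring A] [Algebra ℂ A] (Z : Fin d → A) (P : NCPoly d) : A :=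
  FreeAlgebra.lift ℂ Z P

/-- The monomial `Z^σ`. -/
def monomial (σ : Word d) : NCPoly d := (σ.letters.map (FreeAlgebra.ι ℂ)).prod

variable (d)

/-- The nc disc algebra: the norm-closed unital algebra generated by the left free shift. -/
def discAlgebra : Subalgebra ℂ (Fock d →L[ℂ] Fock d) :=
  (Algebra.adjoin ℂ (Set.range (leftShift (d := d)))).topologicalClosure

/-- The nc disc system: the norm closure of the sum of the nc disc algebra and its adjoint. -/
def discSystem : Submodule ℂ (Fock d →L[ℂ] Fock d) :=
  (Subalgebra.toSubmodule (discAlgebra d) ⊔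
    Subalgebra.toSubmodule (star (discAlgebra d))).topologicalClosure

/-- An nc measure: a linear functional on the nc disc system that is nonnegative on the positive
(semi-definite) operators of the system. -/
structure NCMeasure where
  toLin : discSystem d →ₗ[ℂ] ℂ
  nonneg : ∀ f : discSystem d, 0 ≤ (f : Fock d →L[ℂ] Fock d) → 0 ≤ toLin f

variable {d}

theorem mem_discSystem_of_mem {a : Fock d →L[ℂ] Fock d}
    (h : a ∈ Algebra.adjoin ℂ (Set.range (leftShift (d := d)))) : a ∈ discSystem d :=
  Submodule.le_topologicalClosure _
    (Submodule.mem_sup_left (Subalgebra.le_topologicalClosure _ h))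

theorem star_mem_discSystem_of_mem {a : Fock d →L[ℂ] Fock d}
    (h : a ∈ Algebra.adjoin ℂ (Set.range (leftShift (d := d)))) : star a ∈ discSystem d := by
  refine Submodule.le_topologicalClosure _ (Submodule.mem_sup_right ?_)
  change star a ∈ star (discAlgebra d)
  rw [Subalgebra.star_mem_star_iff]
  exact Subalgebra.le_topologicalClosure _ h

theorem one_mem_discSystem : (1 : Fock d →L[ℂ] Fock d) ∈ discSystem d :=
  mem_discSystem_of_mem (one_mem _)

theorem evalAt_mem_adjoin (P : NCPoly d) :
    evalAt leftShift P ∈ Algebra.adjoin ℂ (Set.range (leftShift (d := d))) := by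
  rw [Algebra.adjoin_range_eq_range_freeAlgebra_lift]
  exact ⟨P, rfl⟩

theorem star_prod_mul_prod_mem (τ σ : List (Fin d)) :
    star (τ.map leftShift).prod * (σ.map leftShift).prod ∈ discSystem d := by
  have key : ∀ ρ : List (Fin d), (ρ.map leftShift).prod ∈
      Algebra.adjoin ℂ (Set.range (leftShift (d := d))) := fun ρ =>
    Subalgebra.list_prod_mem _ (by
      intro x hx
      obtain ⟨i, -, rfl⟩ := List.mem_map.mp hx
      exact Algebra.subset_adjoin ⟨i, rfl⟩)
  induction τ generalizing σ with
  | nil => simpa using mem_discSystem_of_mem (key σ)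
  | cons j τ ih =>
    cases σ with
    | nil =>
      rw [List.map_nil, List.prod_nil, mul_one]
      exact star_mem_discSystem_of_mem (key _)
    | cons k σ =>
      have h : star ((j :: τ).map leftShift).prod * ((k :: σ).map leftShift).prod =
          star (τ.map leftShift).prod * (star (leftShift j) * leftShift k) *
            (σ.map leftShift).prod := by
        simp only [List.map_cons, List.prod_cons, star_mul, mul_assoc]
      rw [h, star_leftShift_mul_leftShift]
      split_ifs
      · rw [mul_one]
        exact ih σ
      · simp

theorem mem_span_prod (P : NCPoly d) : evalAt leftShift P ∈
    Submodule.span ℂ (Set.range fun σ : List (Fin d) => (σ.map leftShift).prod) := by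
  have h := evalAt_mem_adjoin P
  rw [← Subalgebra.mem_toSubmodule, Algebra.adjoin_eq_span] at h
  refine Submodule.span_mono ?_ h
  intro x hx
  induction hx using Submonoid.closure_induction with
  | mem x hx =>
    obtain ⟨i, rfl⟩ := hx
    exact ⟨[i], by simp⟩
  | one => exact ⟨[], by simp⟩
  | mul x y _ _ hx hy =>
    obtain ⟨σ, rfl⟩ := hx
    obtain ⟨τ, rfl⟩ := hy
    exact ⟨σ ++ τ, by simp⟩

/-- `Q(L)^* P(L)` belongs to the nc disc system. -/
theorem star_evalAt_mul_evalAt_mem (P Q : NCPoly d) :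
    star (evalAt leftShift Q) * evalAt leftShift P ∈ discSystem d := by
  refine Submodule.span_induction ?_ ?_ ?_ ?_ (mem_span_prod P)
  · rintro _ ⟨σ, rfl⟩
    refine Submodule.span_induction ?_ ?_ ?_ ?_ (mem_span_prod Q)
    · rintro _ ⟨τ, rfl⟩
      exact star_prod_mul_prod_mem τ σ
    · simp
    · intro x y _ _ hx hy
      rw [star_add, add_mul]
      exact add_mem hx hy
    · intro c x _ hx
      rw [star_smul, smul_mul_assoc]
      exact Submodule.smul_mem _ _ hx
  · simp
  · intro x y _ _ hx hy
    rw [mul_add]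
    exact add_mem hx hy
  · intro c x _ hx
    rw [mul_smul_comm]
    exact Submodule.smul_mem _ _ hx

namespace NCMeasure

variable (μ : NCMeasure d)

/-- The inner product `⟨P, Q⟩_μ = μ(Q^* P)` on nc polynomials, linear in the first variable; here
`Q^* P` stands for the operator `Q(L)^* P(L)`. -/
def innerProd (P Q : NCPoly d) : ℂ :=
  μ.toLin ⟨star (evalAt leftShift Q) * evalAt leftShift P, star_evalAt_mul_evalAt_mem P Q⟩

/-- The norm `‖P‖_μ`. -/
def normOf (P : NCPoly d) : ℝ := Real.sqrt (μ.innerProd P P).re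

/-- The multi-Toeplitz kernel `K_μ(σ, τ) = μ((L^τ)^* L^σ)`. -/
def kernel (σ τ : Word d) : ℂ := μ.innerProd (monomial σ) (monomial τ)

/-- `μ` is non-trivial if all the matrices `[K_μ(σ, τ)]_{σ, τ ⪯ σ₀}` are invertible. -/
def NonTrivial : Prop :=
  ∀ σ₀ : Word d, IsUnit (Matrix.of fun σ τ : Finset.Iic σ₀ => μ.kernel σ τ)

/-- `μ` is a probability nc measure if `μ(I) = 1`. -/
def IsProbability : Prop := μ.toLin ⟨1, one_mem_discSystem⟩ = 1

/-- The orthogonal monic polynomials `Φ_σ`: Gram-Schmidt, without normalisation, for the monomials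
`Z^σ` in the shortlex ordering. -/
def monicPoly (σ : Word d) : NCPoly d :=
  monomial σ - ∑ τ ∈ (Finset.Iio σ).attach,
    (μ.innerProd (monomial σ) (monicPoly τ.1) /
      μ.innerProd (monicPoly τ.1) (monicPoly τ.1)) • monicPoly τ.1
termination_by σ
decreasing_by all_goals exact Finset.mem_Iio.mp τ.2

/-- The orthonormal polynomials `φ_σ`. -/
def orthoPoly (σ : Word d) : NCPoly d :=
  ((μ.normOf (μ.monicPoly σ) : ℂ)⁻¹) • μ.monicPoly σ

/-- The recurrences that define the reverse polynomials `φ^#_σ = ψ σ` of the orthonormal polynomials,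
together with the Verblunsky coefficients `γ σ`:
`φ_{kσ} = (1 - |γ_{kσ}|²)^{-1/2} (Z_k φ_σ - γ_{kσ} φ^#_{kσ-1})` and
`φ^#_{kσ} = (1 - |γ_{kσ}|²)^{-1/2} (- conj γ_{kσ} Z_k φ_σ + φ^#_{kσ-1})`. -/
structure IsReverseFamily (γ : Word d → ℂ) (ψ : Word d → NCPoly d) : Prop where
  coeff_empty : γ Word.empty = 0
  norm_lt_one : ∀ σ, ‖γ σ‖ < 1
  reverse_empty : ψ Word.empty = 1
  ortho_cons : ∀ k σ, μ.orthoPoly (Word.cons k σ) =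
    ((Real.sqrt (1 - ‖γ (Word.cons k σ)‖ ^ 2) : ℂ)⁻¹) •
      (FreeAlgebra.ι ℂ k * μ.orthoPoly σ - γ (Word.cons k σ) • ψ (Word.predCons k σ))
  reverse_cons : ∀ k σ, ψ (Word.cons k σ) =
    ((Real.sqrt (1 - ‖γ (Word.cons k σ)‖ ^ 2) : ℂ)⁻¹) •
      (-(starRingEnd ℂ (γ (Word.cons k σ))) • (FreeAlgebra.ι ℂ k * μ.orthoPoly σ) +
        ψ (Word.predCons k σ))

/-- The coefficient `⟨Z_k φ_σ, R⟩_μ` for a polynomial `R`; with `R = φ^#_{kσ-1}` it is the Verblunsky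
coefficient `γ_{kσ}`. -/
def coeffWith (k : Fin d) (σ : Word d) (R : NCPoly d) : ℂ :=
  μ.innerProd (FreeAlgebra.ι ℂ k * μ.orthoPoly σ) R

/-- One step of the recurrence for the reverse polynomials, from `R = φ^#_{kσ-1}` to `φ^#_{kσ}`. -/
def reverseStep (k : Fin d) (σ : Word d) (R : NCPoly d) : NCPoly d :=
  ((Real.sqrt (1 - ‖μ.coeffWith k σ R‖ ^ 2) : ℂ)⁻¹) •
    (-(starRingEnd ℂ (μ.coeffWith k σ R)) • (FreeAlgebra.ι ℂ k * μ.orthoPoly σ) + R)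

/-- The reverse polynomials `φ^#_σ` of the orthonormal polynomials. -/
def reversePoly (σ : Word d) : NCPoly d :=
  match σ with
  | .empty => 1
  | .cons k τ => μ.reverseStep k τ (reversePoly (Word.predCons k τ))
termination_by σ
decreasing_by exact Word.predCons_lt k τ

/-- The Verblunsky coefficients `γ_σ`. -/
def verblunsky (σ : Word d) : ℂ :=
  match σ with
  | .empty => 0
  | .cons k τ => μ.coeffWith k τ (μ.reversePoly (Word.predCons k τ))

end NCMeasure

/-! ### The row-ball, its exterior and its distinguished boundary -/

section Matrices

variable {m : ℕ}

/-- The matrix `Z_1 Z_1^* + ⋯ + Z_d Z_d^*`. -/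
def rowGram (Z : Fin d → Matrix (Fin m) (Fin m) ℂ) : Matrix (Fin m) (Fin m) ℂ :=
  ∑ k, Z k * (Z k).conjTranspose

/-- `Z` lies in the row-ball: `∑ Z_k Z_k^* < I`. -/
def InRowBall (Z : Fin d → Matrix (Fin m) (Fin m) ℂ) : Prop := (1 - rowGram Z).PosDef

/-- `Z` lies in the exterior of the closed row-ball: `∑ Z_k Z_k^* > I`. -/
def InExterior (Z : Fin d → Matrix (Fin m) (Fin m) ℂ) : Prop := (rowGram Z - 1).PosDef

/-- `Z` is a row co-isometry: `∑ Z_k Z_k^* = I`. -/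
def IsRowCoisometry (Z : Fin d → Matrix (Fin m) (Fin m) ℂ) : Prop := rowGram Z = 1

/-- The matrix `P(Z^*)^* P(Z^*)`, where `Z^* = (Z_1^*, …, Z_d^*)`. -/
def sqAtStar (P : NCPoly d) (Z : Fin d → Matrix (Fin m) (Fin m) ℂ) : Matrix (Fin m) (Fin m) ℂ :=
  (evalAt (fun k => (Z k).conjTranspose) P).conjTranspose *
    evalAt (fun k => (Z k).conjTranspose) P

end Matrices

end NCZeros

end

/-!
The operators `P ↦ Z_k P` are isometries with pairwise orthogonal ranges for the inner product of
an nc measure (`innerProd_ι_mul_ι_mul`), so the vectors `Z_k φ_τ` with `kτ ⪯ σ` are orthonormal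
and span the combinations of the monomials `Z^ρ` with `∅ ≺ ρ ⪯ σ`. Up to a unimodular factor there
is one unit vector `φ^#_σ` that completes them to an orthonormal basis of the span of all `Z^ρ`
with `ρ ⪯ σ` (`IsReverseAt`). Passing from `kσ - 1` to `kσ`, the component of `Z_k φ_σ` orthogonal
to `φ^#_{kσ-1}` is orthogonal to all earlier monomials and has positive leading coefficient, hence
is a positive multiple of `φ_{kσ}`. This gives both recurrences, and `|γ_{kσ}| < 1` because that
component is nonzero when `μ` is non-trivial (`IsReverseAt.orthoPoly_cons`). Conversely any
solution of the recurrences has `γ_{kσ} = ⟨Z_k φ_σ, φ^#_{kσ-1}⟩_μ`, since `φ_{kσ}` is orthogonal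
to `φ^#_{kσ-1}` (`IsReverseFamily.eq_reversePoly`).

The recurrence matrix `(1 - |γ|²)^{-1/2} [[1, -γ], [-γ̄, 1]]` preserves the form `AᴴA - BᴴB`
(`sq_sub_sq_of_recurrence`). Evaluating at `Z^*` and telescoping over the words up to `σ(n)`
yields the Christoffel-Darboux identity (`christoffel_darboux`), with `R = ∑ Z_k Z_k^*`:
`φ^#_{σ(n)}(Z^*)^* φ^#_{σ(n)}(Z^*) = ∑_{|σ| = n} φ_σ(Z^*)^* φ_σ(Z^*)
  + ∑_{|ρ| < n} φ_ρ(Z^*)^* (I - R) φ_ρ(Z^*)`.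
As `φ_∅ = 1`, the last sum is positive definite in the row-ball and negative definite in the
exterior once `n ≥ 1`, which gives nonsingularity there (for `n = 0` both matrices are `I`);
it vanishes if `R = I`. In that case a
null vector of the common value is annihilated by `φ^#_{σ(n)}(Z^*)` and by all `φ_σ(Z^*)` with
`|σ| = n`. Solving the recurrence for the polynomials of lower index, it is annihilated by
`φ^#_{σ(n-1)}(Z^*)` and by all `Z_k^* φ_ρ(Z^*)` with `|ρ| = n - 1`, hence by all `φ_ρ(Z^*)`
because `R = I`, and finally by `φ_∅ = 1` (`eq_zero_of_mulVec_eq_zero`).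
-/

open scoped ComplexOrder

noncomputable section

namespace NCZeros

/-! ### The shortlex ordering -/

namespace Word

variable {d : ℕ}

@[simp] theorem length_empty : (empty : Word d).length = 0 := rfl

@[simp] theorem length_cons (k : Fin d) (σ : Word d) : (cons k σ).length = σ.length + 1 := rfl

theorem empty_le (σ : Word d) : empty ≤ σ := by
  cases σ with
  | empty => exact le_rfl
  | cons k σ => exact (empty_lt_cons k σ).le

theorem cons_lt_cons {k : Fin d} {σ τ : Word d} : cons k τ < cons k σ ↔ τ < σ := by
  rw [lt_iff, lt_iff]
  simp [letters, List.lex_cons_iff]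

theorem cons_le_cons {k : Fin d} {σ τ : Word d} : cons k τ ≤ cons k σ ↔ τ ≤ σ := by
  rw [← not_lt, ← not_lt, cons_lt_cons]

theorem lt_cons_iff {k : Fin d} {σ τ : Word d} : τ < cons k σ ↔ τ ≤ predCons k σ :=
  ⟨fun h => Finset.le_max' _ _ (Finset.mem_Iio.mpr h), fun h => h.trans_lt (predCons_lt k σ)⟩

theorem Iic_cons (k : Fin d) (σ : Word d) :
    Finset.Iic (cons k σ) = insert (cons k σ) (Finset.Iic (predCons k σ)) := by
  ext τ
  rw [Finset.mem_insert, Finset.mem_Iic, Finset.mem_Iic, ← lt_cons_iff, le_iff_eq_or_lt]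

theorem mem_ofLength {n : ℕ} {σ : Word d} : σ ∈ ofLength d n ↔ σ.length = n := by
  simp [ofLength, length]

theorem ofLength_zero : ofLength d 0 = {empty} := by
  ext τ
  rw [mem_ofLength, Finset.mem_singleton]
  cases τ <;> simp

theorem sum_ofLength_succ {M : Type*} [AddCommMonoid M] (n : ℕ) (g : Word d → M) :
    ∑ τ ∈ ofLength d (n + 1), g τ = ∑ ρ ∈ ofLength d n, ∑ k, g (cons k ρ) := by
  rw [← Finset.sum_product']
  symm
  refine Finset.sum_bij (fun x _ => cons x.2 x.1) ?_ ?_ ?_ ?_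
  · rintro ⟨ρ, k⟩ h
    simpa [mem_ofLength] using h
  · rintro ⟨ρ, k⟩ - ⟨ρ', k'⟩ - h
    simp only [cons.injEq] at h
    simp [h.1, h.2]
  · intro τ hτ
    cases τ with
    | empty => simp [mem_ofLength] at hτ
    | cons k ρ => exact ⟨(ρ, k), by simpa [mem_ofLength] using hτ, rfl⟩
  · simp

variable [NeZero d]

theorem length_final (n : ℕ) : (final d n).length = n := by
  simp [final, length, letters_ofLetters]

theorem not_lex_replicate (l : List (Fin d)) : ∀ n : ℕ,
    ¬ (n = l.length ∧
      List.Lex (· < ·) (List.replicate n (⟨d - 1, Nat.sub_one_lt (NeZero.ne d)⟩ : Fin d)) l) := by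
  induction l with
  | nil => simp
  | cons k l ih =>
    rintro (_ | n) ⟨hn, h⟩
    · simp at hn
    · rw [List.replicate_succ] at h
      cases h with
      | rel h =>
        have h1 := k.2
        rw [Fin.lt_def] at h
        simp only at h
        omega
      | cons h => exact ih n ⟨by simpa using hn, h⟩

/-- `σ(n)` is the last word of length at most `n`. -/
theorem le_final_iff {n : ℕ} {σ : Word d} : σ ≤ final d n ↔ σ.length ≤ n := by
  refine ⟨fun h => (length_le_of_le h).trans (length_final n).le, fun h => not_lt.mp fun h' => ?_⟩
  rcases (lt_iff _ _).mp h' with h' | ⟨h1, h2⟩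
  · rw [length_final] at h'
    omega
  · rw [length_final] at h1
    rw [final, letters_ofLetters] at h2
    exact not_lex_replicate _ _ ⟨h1, h2⟩

theorem Iic_final_succ (n : ℕ) :
    Finset.Iic (final d (n + 1)) = Finset.Iic (final d n) ∪ ofLength d (n + 1) := by
  ext τ
  rw [Finset.mem_union, Finset.mem_Iic, Finset.mem_Iic, le_final_iff, le_final_iff, mem_ofLength]
  omega

theorem disjoint_Iic_final_ofLength (n : ℕ) :
    Disjoint (Finset.Iic (final d n)) (ofLength d (n + 1)) := by
  rw [Finset.disjoint_left]
  intro τ h h'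
  rw [Finset.mem_Iic, le_final_iff] at h
  rw [mem_ofLength] at h'
  omega

end Word

/-! ### Evaluation and monomials -/

variable {d : ℕ}

section Eval

variable {A : Type*} [Semiring A] [Algebra ℂ A] (Z : Fin d → A)

@[simp] theorem evalAt_add (P Q : NCPoly d) : evalAt Z (P + Q) = evalAt Z P + evalAt Z Q :=
  map_add _ P Q

@[simp] theorem evalAt_sub {A : Type*} [Ring A] [Algebra ℂ A] (Z : Fin d → A) (P Q : NCPoly d) :
    evalAt Z (P - Q) = evalAt Z P - evalAt Z Q :=
  map_sub (FreeAlgebra.lift ℂ Z) P Q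

@[simp] theorem evalAt_smul (c : ℂ) (P : NCPoly d) : evalAt Z (c • P) = c • evalAt Z P :=
  map_smul _ c P

@[simp] theorem evalAt_mul (P Q : NCPoly d) : evalAt Z (P * Q) = evalAt Z P * evalAt Z Q :=
  map_mul _ P Q

@[simp] theorem evalAt_one : evalAt Z (1 : NCPoly d) = 1 := map_one _

@[simp] theorem evalAt_ι (k : Fin d) : evalAt Z (FreeAlgebra.ι ℂ k) = Z k :=
  FreeAlgebra.lift_ι_apply _ _

end Eval

theorem monomial_empty : monomial (Word.empty : Word d) = 1 := rfl

theorem monomial_cons (k : Fin d) (σ : Word d) :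
    monomial (Word.cons k σ) = FreeAlgebra.ι ℂ k * monomial σ := by
  simp [monomial, Word.letters]

/-- The nc polynomials whose monomials are indexed by a set `s` of words. -/
def polySpan (s : Set (Word d)) : Submodule ℂ (NCPoly d) := Submodule.span ℂ (monomial '' s)

theorem monomial_mem_polySpan {s : Set (Word d)} {σ : Word d} (h : σ ∈ s) :
    monomial σ ∈ polySpan s :=
  Submodule.subset_span ⟨σ, h, rfl⟩

theorem polySpan_mono {s t : Set (Word d)} (h : s ⊆ t) : polySpan s ≤ polySpan t :=
  Submodule.span_mono (Set.image_mono h)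

theorem ι_mul_mem_polySpan (k : Fin d) {s : Set (Word d)} {P : NCPoly d} (hP : P ∈ polySpan s) :
    FreeAlgebra.ι ℂ k * P ∈ polySpan (Word.cons k '' s) := by
  induction hP using Submodule.span_induction with
  | mem x hx =>
    obtain ⟨σ, hσ, rfl⟩ := hx
    rw [← monomial_cons]
    exact monomial_mem_polySpan ⟨σ, hσ, rfl⟩
  | zero => simp
  | add x y _ _ hx hy =>
    rw [mul_add]
    exact add_mem hx hy
  | smul c x _ hx =>
    rw [mul_smul_comm]
    exact Submodule.smul_mem _ _ hx

namespace NCMeasure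

/-! ### The inner product of an nc measure -/

variable (μ : NCMeasure d)

theorem innerProd_add_left (P P' Q : NCPoly d) :
    μ.innerProd (P + P') Q = μ.innerProd P Q + μ.innerProd P' Q := by
  rw [innerProd, innerProd, innerProd, ← map_add]
  congr 1
  ext1
  simp [mul_add]

theorem innerProd_add_right (P Q Q' : NCPoly d) :
    μ.innerProd P (Q + Q') = μ.innerProd P Q + μ.innerProd P Q' := by
  rw [innerProd, innerProd, innerProd, ← map_add]
  congr 1
  ext1
  simp [add_mul]

theorem innerProd_smul_left (c : ℂ) (P Q : NCPoly d) :
    μ.innerProd (c • P) Q = c * μ.innerProd P Q := by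
  refine Eq.trans ?_ (map_smul μ.toLin c _)
  rw [innerProd]
  congr 1
  ext1
  simp

theorem innerProd_smul_right (c : ℂ) (P Q : NCPoly d) :
    μ.innerProd P (c • Q) = starRingEnd ℂ c * μ.innerProd P Q := by
  refine Eq.trans ?_ (map_smul μ.toLin (starRingEnd ℂ c) _)
  rw [innerProd]
  congr 1
  ext1
  simp

theorem innerProd_self_nonneg (P : NCPoly d) : 0 ≤ μ.innerProd P P :=
  μ.nonneg _ (star_mul_self_nonneg _)

/-- A sesquilinear form with real diagonal is hermitian. -/
theorem conj_innerProd (P Q : NCPoly d) :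
    starRingEnd ℂ (μ.innerProd P Q) = μ.innerProd Q P := by
  have him : ∀ R, (μ.innerProd R R).im = 0 := fun R =>
    ((Complex.nonneg_iff.mp (μ.innerProd_self_nonneg R)).2).symm
  have h1 := him (P + Q)
  have h2 := him (P + Complex.I • Q)
  have hP := him P
  have hQ := him Q
  simp only [innerProd_add_left, innerProd_add_right, innerProd_smul_left, innerProd_smul_right,
    Complex.add_im, Complex.add_re, Complex.mul_im, Complex.mul_re, Complex.conj_I, Complex.I_re,
    Complex.I_im, Complex.neg_im, Complex.neg_re] at h1 h2
  apply Complex.ext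
  · rw [Complex.conj_re]
    linarith
  · rw [Complex.conj_im]
    linarith

/-- The creation operators `P ↦ Z_k P` are isometries with pairwise orthogonal ranges. -/
theorem innerProd_ι_mul_ι_mul (j k : Fin d) (P Q : NCPoly d) :
    μ.innerProd (FreeAlgebra.ι ℂ j * P) (FreeAlgebra.ι ℂ k * Q) =
      if j = k then μ.innerProd P Q else 0 := by
  have h : star (evalAt leftShift (FreeAlgebra.ι ℂ k * Q)) *
      evalAt leftShift (FreeAlgebra.ι ℂ j * P) =
        if j = k then star (evalAt leftShift Q) * evalAt leftShift P else 0 := by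
    rw [evalAt_mul, evalAt_mul, star_mul, evalAt_ι, evalAt_ι, mul_assoc,
      ← mul_assoc (star (leftShift k)), star_leftShift_mul_leftShift]
    simp only [eq_comm (a := k)]
    split_ifs <;> simp
  rw [innerProd]
  split_ifs with hjk
  · rw [innerProd]
    congr 1
    ext1
    exact h.trans (if_pos hjk)
  · rw [← map_zero μ.toLin]
    congr 1
    ext1
    exact h.trans (if_neg hjk)

theorem innerProd_one_one (h : μ.IsProbability) : μ.innerProd 1 1 = 1 := by
  refine Eq.trans ?_ h
  rw [innerProd]
  congr 1
  ext1
  simp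

/-- The form `⟨·, ·⟩_μ` as a Mathlib inner product, conjugate-linear in the first variable. -/
abbrev preCore : PreInnerProductSpace.Core ℂ (NCPoly d) where
  inner P Q := μ.innerProd Q P
  conj_inner_symm P Q := μ.conj_innerProd P Q
  re_inner_nonneg P := (Complex.nonneg_iff.mp (μ.innerProd_self_nonneg P)).1
  add_left P Q R := μ.innerProd_add_right R P Q
  smul_left P Q c := μ.innerProd_smul_right c Q P

theorem innerProd_eq_zero_of_self {P : NCPoly d} (h : μ.innerProd P P = 0) (Q : NCPoly d) :
    μ.innerProd P Q = 0 := by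
  have key := @InnerProductSpace.Core.inner_mul_inner_self_le ℂ (NCPoly d) _ _ _ μ.preCore P Q
  change ‖μ.innerProd Q P‖ * ‖μ.innerProd P Q‖ ≤ RCLike.re (μ.innerProd P P) * _ at key
  rw [h, map_zero, zero_mul, ← μ.conj_innerProd P Q, RCLike.norm_conj] at key
  exact norm_eq_zero.mp (mul_self_eq_zero.mp (le_antisymm key (mul_self_nonneg _)))

/-- The linear functional `⟨·, Q⟩_μ`. -/
def innerLeft (Q : NCPoly d) : NCPoly d →ₗ[ℂ] ℂ where
  toFun P := μ.innerProd P Q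
  map_add' P P' := μ.innerProd_add_left P P' Q
  map_smul' c P := μ.innerProd_smul_left c P Q

theorem innerProd_sub_left (P P' Q : NCPoly d) :
    μ.innerProd (P - P') Q = μ.innerProd P Q - μ.innerProd P' Q := map_sub (μ.innerLeft Q) P P'

theorem innerProd_sum_left {ι : Type*} (s : Finset ι) (f : ι → NCPoly d) (Q : NCPoly d) :
    μ.innerProd (∑ i ∈ s, f i) Q = ∑ i ∈ s, μ.innerProd (f i) Q := map_sum (μ.innerLeft Q) f s

theorem innerProd_sub_right (P Q Q' : NCPoly d) :
    μ.innerProd P (Q - Q') = μ.innerProd P Q - μ.innerProd P Q' := by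
  rw [← conj_innerProd, innerProd_sub_left, map_sub, conj_innerProd, conj_innerProd]

theorem innerProd_eq_zero_symm {P Q : NCPoly d} (h : μ.innerProd P Q = 0) :
    μ.innerProd Q P = 0 := by
  rw [← conj_innerProd, h, map_zero]

theorem innerProd_eq_zero_of_mem_span {s : Set (NCPoly d)} {P Q : NCPoly d}
    (hP : P ∈ Submodule.span ℂ s) (h : ∀ x ∈ s, μ.innerProd x Q = 0) : μ.innerProd P Q = 0 := by
  have hs : Submodule.span ℂ s ≤ LinearMap.ker (μ.innerLeft Q) :=
    Submodule.span_le.mpr fun x hx => LinearMap.mem_ker.mpr (h x hx)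
  exact LinearMap.mem_ker.mp (hs hP)

theorem innerProd_eq_zero_of_mem_polySpan {s : Set (Word d)} {P Q : NCPoly d}
    (hP : P ∈ polySpan s) (h : ∀ τ ∈ s, μ.innerProd (monomial τ) Q = 0) :
    μ.innerProd P Q = 0 :=
  μ.innerProd_eq_zero_of_mem_span hP (by rintro _ ⟨τ, hτ, rfl⟩; exact h τ hτ)

theorem innerProd_self (P : NCPoly d) : μ.innerProd P P = (μ.normOf P : ℂ) ^ 2 := by
  have h := Complex.nonneg_iff.mp (μ.innerProd_self_nonneg P)
  rw [normOf, ← Complex.ofReal_pow, Real.sq_sqrt h.1]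
  exact Complex.ext rfl (by rw [← h.2, Complex.ofReal_im])

theorem normOf_smul (b : ℝ) (hb : 0 ≤ b) (P : NCPoly d) :
    μ.normOf ((b : ℂ) • P) = b * μ.normOf P := by
  have h : (μ.innerProd ((b : ℂ) • P) ((b : ℂ) • P)).re = b ^ 2 * (μ.innerProd P P).re := by
    rw [innerProd_smul_left, innerProd_smul_right, Complex.conj_ofReal, Complex.re_ofReal_mul,
      Complex.re_ofReal_mul]
    ring
  rw [normOf, h, Real.sqrt_mul (sq_nonneg b), Real.sqrt_sq hb, normOf]

/-! ### Definiteness for non-trivial nc measures -/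

theorem coeff_eq_zero_of_innerProd_self {μ : NCMeasure d} (hμ : μ.NonTrivial) (σ₀ : Word d)
    (c : Word d → ℂ)
    (h : μ.innerProd (∑ τ ∈ Finset.Iic σ₀, c τ • monomial τ)
      (∑ τ ∈ Finset.Iic σ₀, c τ • monomial τ) = 0) (τ : Word d) (hτ : τ ≤ σ₀) : c τ = 0 := by
  -- By Cauchy-Schwarz the polynomial is orthogonal to every `Z^ρ`, so `c` is a left null vector
  -- of the kernel matrix.
  have hinj := Matrix.vecMul_injective_iff_isUnit.mpr (hμ σ₀)
  have h0 : (fun τ : Finset.Iic σ₀ => c τ) = 0 := by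
    refine hinj ?_
    refine Eq.trans ?_ (Matrix.zero_vecMul _).symm
    ext ρ
    have h1 := μ.innerProd_eq_zero_of_self h (monomial ρ.1)
    simp only [innerProd_sum_left, innerProd_smul_left] at h1
    rw [← Finset.sum_coe_sort] at h1
    exact h1
  exact congrFun h0 ⟨τ, Finset.mem_Iic.mpr hτ⟩

theorem exists_coeff_of_mem_polySpan {s : Finset (Word d)} {P : NCPoly d}
    (hP : P ∈ polySpan (s : Set (Word d))) : ∃ c : Word d → ℂ, P = ∑ τ ∈ s, c τ • monomial τ := by
  obtain ⟨c, hc⟩ := Submodule.mem_span_image_finset_iff_exists_fun ℂ |>.mp hP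
  refine ⟨fun τ => if h : τ ∈ s then c ⟨τ, h⟩ else 0, ?_⟩
  rw [← hc, ← Finset.sum_coe_sort s]
  exact Finset.sum_congr rfl fun τ _ => by simp [τ.2]

theorem eq_zero_of_innerProd_self {μ : NCMeasure d} (hμ : μ.NonTrivial) {σ₀ : Word d}
    {P : NCPoly d} (hP : P ∈ polySpan (Set.Iic σ₀)) (h : μ.innerProd P P = 0) : P = 0 := by
  rw [← Finset.coe_Iic] at hP
  obtain ⟨c, rfl⟩ := exists_coeff_of_mem_polySpan hP
  refine Finset.sum_eq_zero fun τ hτ => ?_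
  rw [coeff_eq_zero_of_innerProd_self hμ σ₀ c h τ (Finset.mem_Iic.mp hτ), zero_smul]

/-- A polynomial with leading monomial `Z^σ` has nonzero norm. -/
theorem normOf_pos {μ : NCMeasure d} (hμ : μ.NonTrivial) {σ : Word d} {P : NCPoly d}
    (hP : P - monomial σ ∈ polySpan (Set.Iio σ)) : 0 < μ.normOf P := by
  refine (Real.sqrt_nonneg _).lt_of_ne' fun h0 => ?_
  have h : μ.innerProd P P = 0 := by
    rw [innerProd_self, normOf, h0]
    simp
  rw [← Finset.coe_Iio] at hP
  obtain ⟨c, hc⟩ := exists_coeff_of_mem_polySpan hP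
  have hP' : P = ∑ τ ∈ Finset.Iic σ, Function.update c σ 1 τ • monomial τ := by
    rw [← Finset.Iio_insert, Finset.sum_insert (by simp), Function.update_self, one_smul,
      ← sub_eq_iff_eq_add', hc]
    refine Finset.sum_congr rfl fun τ hτ => ?_
    rw [Function.update_of_ne (Finset.mem_Iio.mp hτ).ne]
  rw [hP'] at h
  have h1 := coeff_eq_zero_of_innerProd_self hμ σ _ h σ le_rfl
  rw [Function.update_self] at h1
  exact one_ne_zero h1

/-! ### The orthonormal polynomials -/

theorem monomial_sub_monicPoly_mem (σ : Word d) : monomial σ - μ.monicPoly σ ∈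
    Submodule.span ℂ (μ.monicPoly '' Set.Iio σ) := by
  rw [monicPoly, sub_sub_cancel]
  exact Submodule.sum_mem _ fun τ _ => Submodule.smul_mem _ _
    (Submodule.subset_span ⟨τ.1, Finset.mem_Iio.mp τ.2, rfl⟩)

theorem monicPoly_sub_monomial_mem (σ : Word d) :
    μ.monicPoly σ - monomial σ ∈ polySpan (Set.Iio σ) := by
  induction σ using WellFoundedLT.induction with
  | ind σ ih =>
    rw [← neg_mem_iff, neg_sub]
    refine Submodule.span_le.mpr ?_ (μ.monomial_sub_monicPoly_mem σ)
    rintro _ ⟨τ, hτ, rfl⟩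
    rw [SetLike.mem_coe, ← sub_add_cancel (μ.monicPoly τ) (monomial τ)]
    exact add_mem (polySpan_mono (Set.Iio_subset_Iio (le_of_lt hτ)) (ih τ hτ))
      (monomial_mem_polySpan hτ)

theorem innerProd_monicPoly_of_lt {μ : NCMeasure d} (hμ : μ.NonTrivial) (σ : Word d) :
    ∀ τ < σ, μ.innerProd (μ.monicPoly σ) (μ.monicPoly τ) = 0 := by
  induction σ using WellFoundedLT.induction with
  | ind σ ih =>
    intro τ hτ
    have hne : μ.innerProd (μ.monicPoly τ) (μ.monicPoly τ) ≠ 0 := by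
      rw [innerProd_self]
      exact pow_ne_zero 2 (Complex.ofReal_ne_zero.mpr
        (normOf_pos hμ (μ.monicPoly_sub_monomial_mem τ)).ne')
    rw [monicPoly, innerProd_sub_left, innerProd_sum_left,
      Finset.sum_eq_single ⟨τ, Finset.mem_Iio.mpr hτ⟩, innerProd_smul_left, div_mul_cancel₀ _ hne,
      sub_self]
    · rintro ⟨ρ, hρ⟩ - hne
      rw [innerProd_smul_left]
      rcases lt_trichotomy ρ τ with h | h | h
      · rw [μ.innerProd_eq_zero_symm (ih τ hτ ρ h), mul_zero]
      · exact absurd (Subtype.ext h) hne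
      · rw [ih ρ (Finset.mem_Iio.mp hρ) τ h, mul_zero]
    · exact fun h => absurd (Finset.mem_attach _ _) h

theorem innerProd_monomial_monicPoly {μ : NCMeasure d} (hμ : μ.NonTrivial) {σ τ : Word d}
    (h : τ < σ) : μ.innerProd (monomial τ) (μ.monicPoly σ) = 0 := by
  rw [← sub_add_cancel (monomial τ) (μ.monicPoly τ), innerProd_add_left,
    μ.innerProd_eq_zero_symm (innerProd_monicPoly_of_lt hμ σ τ h), add_zero]
  refine μ.innerProd_eq_zero_of_mem_span (μ.monomial_sub_monicPoly_mem τ) ?_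
  rintro _ ⟨ρ, hρ, rfl⟩
  exact μ.innerProd_eq_zero_symm (innerProd_monicPoly_of_lt hμ σ ρ (lt_trans hρ h))

theorem innerProd_monomial_orthoPoly {μ : NCMeasure d} (hμ : μ.NonTrivial) {σ τ : Word d}
    (h : τ < σ) : μ.innerProd (monomial τ) (μ.orthoPoly σ) = 0 := by
  rw [orthoPoly, innerProd_smul_right, innerProd_monomial_monicPoly hμ h, mul_zero]

theorem normOf_monicPoly_pos {μ : NCMeasure d} (hμ : μ.NonTrivial) (σ : Word d) :
    0 < μ.normOf (μ.monicPoly σ) :=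
  normOf_pos hμ (μ.monicPoly_sub_monomial_mem σ)

theorem innerProd_orthoPoly_self {μ : NCMeasure d} (hμ : μ.NonTrivial) (σ : Word d) :
    μ.innerProd (μ.orthoPoly σ) (μ.orthoPoly σ) = 1 := by
  have h := normOf_monicPoly_pos hμ σ
  rw [innerProd_self, orthoPoly, ← Complex.ofReal_inv, normOf_smul _ _ (inv_pos.mpr h).le,
    inv_mul_cancel₀ h.ne', Complex.ofReal_one, one_pow]

theorem orthoPoly_sub_monomial_mem (σ : Word d) :
    μ.orthoPoly σ - ((μ.normOf (μ.monicPoly σ) : ℂ)⁻¹) • monomial σ ∈ polySpan (Set.Iio σ) := by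
  rw [orthoPoly, ← smul_sub]
  exact Submodule.smul_mem _ _ (μ.monicPoly_sub_monomial_mem σ)

theorem orthoPoly_mem_polySpan (σ : Word d) : μ.orthoPoly σ ∈ polySpan (Set.Iic σ) := by
  rw [← sub_add_cancel (μ.orthoPoly σ) (((μ.normOf (μ.monicPoly σ) : ℂ)⁻¹) • monomial σ)]
  exact add_mem (polySpan_mono Set.Iio_subset_Iic_self (μ.orthoPoly_sub_monomial_mem σ))
    (Submodule.smul_mem _ _ (monomial_mem_polySpan Set.self_mem_Iic))

/-- The orthonormal polynomial `φ_σ` is characterised, up to normalisation, by orthogonality to the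
earlier monomials and a positive leading coefficient. -/
theorem orthoPoly_eq_of_orthogonal {μ : NCMeasure d} (hμ : μ.NonTrivial) {σ : Word d}
    {P : NCPoly d} {b : ℝ} (hb : 0 < b) (hP : P - (b : ℂ) • monomial σ ∈ polySpan (Set.Iio σ))
    (horth : ∀ τ < σ, μ.innerProd (monomial τ) P = 0) :
    0 < μ.normOf P ∧ μ.orthoPoly σ = ((μ.normOf P : ℂ)⁻¹) • P := by
  have hmem : P - (b : ℂ) • μ.monicPoly σ ∈ polySpan (Set.Iio σ) := by
    have h := sub_mem hP (Submodule.smul_mem _ (b : ℂ) (μ.monicPoly_sub_monomial_mem σ))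
    rwa [smul_sub, sub_sub_sub_cancel_right] at h
  have hPb : P = (b : ℂ) • μ.monicPoly σ := by
    refine sub_eq_zero.mp (eq_zero_of_innerProd_self hμ
      (polySpan_mono Set.Iio_subset_Iic_self hmem) ?_)
    refine μ.innerProd_eq_zero_of_mem_polySpan hmem fun τ hτ => ?_
    rw [innerProd_sub_right, innerProd_smul_right, horth τ hτ, innerProd_monomial_monicPoly hμ hτ,
      mul_zero, sub_zero]
  have hpos := normOf_monicPoly_pos hμ σ
  have hn : μ.normOf P = b * μ.normOf (μ.monicPoly σ) := by rw [hPb, normOf_smul _ _ hb.le]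
  refine ⟨hn ▸ mul_pos hb hpos, ?_⟩
  have hb' : (b : ℂ) ≠ 0 := Complex.ofReal_ne_zero.mpr hb.ne'
  rw [hn, hPb, smul_smul, orthoPoly, Complex.ofReal_mul, mul_inv_rev, mul_assoc,
    inv_mul_cancel₀ hb', mul_one]

theorem orthoPoly_empty (hμ1 : μ.IsProbability) : μ.orthoPoly Word.empty = 1 := by
  have h : μ.monicPoly Word.empty = 1 := by
    rw [monicPoly, Finset.sum_eq_zero, sub_zero, monomial_empty]
    rintro ⟨τ, hτ⟩ -
    exact absurd (Finset.mem_Iio.mp hτ) (Word.empty_le τ).not_gt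
  have hn : μ.normOf 1 = 1 := by
    rw [normOf, μ.innerProd_one_one hμ1, Complex.one_re, Real.sqrt_one]
  rw [orthoPoly, h, hn, Complex.ofReal_one, inv_one, one_smul]

/-! ### The reverse polynomials -/

/-- `R` is, up to a unimodular factor, the reverse polynomial of index `σ`: the unit vector of the
span of the monomials up to `Z^σ` that is orthogonal to those of positive degree. Its constant
coefficient is required to be nonzero, so that together with these monomials `R` spans the
constants. -/
structure IsReverseAt (σ : Word d) (R : NCPoly d) : Prop where
  norm_eq_one : μ.innerProd R R = 1
  orthogonal : ∀ k τ, Word.cons k τ ≤ σ → μ.innerProd (monomial (Word.cons k τ)) R = 0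
  constant_coeff : ∃ c : ℂ, c ≠ 0 ∧ R - c • 1 ∈ polySpan (Set.Ioc Word.empty σ)

variable {μ}

theorem IsReverseAt.mem_polySpan {σ : Word d} {R : NCPoly d} (h : μ.IsReverseAt σ R) :
    R ∈ polySpan (Set.Iic σ) := by
  obtain ⟨c, -, hc⟩ := h.constant_coeff
  rw [← sub_add_cancel R (c • 1)]
  refine add_mem (polySpan_mono Set.Ioc_subset_Iic_self hc) (Submodule.smul_mem _ _ ?_)
  exact monomial_empty (d := d) ▸ monomial_mem_polySpan (Word.empty_le σ)

theorem isReverseAt_empty (hμ1 : μ.IsProbability) : μ.IsReverseAt Word.empty 1 where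
  norm_eq_one := μ.innerProd_one_one hμ1
  orthogonal k τ h := absurd h (Word.empty_lt_cons k τ).not_ge
  constant_coeff := ⟨1, one_ne_zero, by simp⟩

theorem image_cons_Iio_subset (k : Fin d) (σ : Word d) :
    Word.cons k '' Set.Iio σ ⊆ Set.Iio (Word.cons k σ) := by
  rintro _ ⟨τ, hτ, rfl⟩
  exact Word.cons_lt_cons.mpr hτ

theorem Iio_cons (k : Fin d) (σ : Word d) :
    Set.Iio (Word.cons k σ) = Set.Iic (Word.predCons k σ) :=
  Set.ext fun _ => Word.lt_cons_iff

theorem innerProd_monomial_ι_mul_orthoPoly (hμ : μ.NonTrivial) {j k : Fin d} {σ τ : Word d}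
    (h : Word.cons j τ < Word.cons k σ) :
    μ.innerProd (monomial (Word.cons j τ)) (FreeAlgebra.ι ℂ k * μ.orthoPoly σ) = 0 := by
  rw [monomial_cons, innerProd_ι_mul_ι_mul]
  split_ifs with hjk
  · subst hjk
    exact innerProd_monomial_orthoPoly hμ (Word.cons_lt_cons.mp h)
  · rfl

theorem innerProd_ι_mul_orthoPoly_self (hμ : μ.NonTrivial) (k : Fin d) (σ : Word d) :
    μ.innerProd (FreeAlgebra.ι ℂ k * μ.orthoPoly σ) (FreeAlgebra.ι ℂ k * μ.orthoPoly σ) = 1 := by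
  rw [innerProd_ι_mul_ι_mul, if_pos rfl, innerProd_orthoPoly_self hμ]

theorem ι_mul_orthoPoly_sub_mem (μ : NCMeasure d) (k : Fin d) (σ : Word d) :
    FreeAlgebra.ι ℂ k * μ.orthoPoly σ -
      ((μ.normOf (μ.monicPoly σ) : ℂ)⁻¹) • monomial (Word.cons k σ) ∈
        polySpan (Word.cons k '' Set.Iio σ) := by
  have h := ι_mul_mem_polySpan k (μ.orthoPoly_sub_monomial_mem σ)
  rwa [mul_sub, mul_smul_comm, ← monomial_cons] at h

/-- The part `Z_k φ_σ - γ φ^#_{kσ-1}` of the recurrence is orthogonal to all earlier monomials. -/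
theorem IsReverseAt.orthogonal_sub (hμ : μ.NonTrivial) {k : Fin d} {σ : Word d} {R : NCPoly d}
    (h : μ.IsReverseAt (Word.predCons k σ) R) (τ : Word d) (hτ : τ < Word.cons k σ) :
    μ.innerProd (monomial τ)
      (FreeAlgebra.ι ℂ k * μ.orthoPoly σ - μ.coeffWith k σ R • R) = 0 := by
  set D := FreeAlgebra.ι ℂ k * μ.orthoPoly σ - μ.coeffWith k σ R • R with hD
  have hcons : ∀ j ρ, Word.cons j ρ < Word.cons k σ →
      μ.innerProd (monomial (Word.cons j ρ)) D = 0 := by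
    intro j ρ hρ
    rw [hD, innerProd_sub_right, innerProd_smul_right, h.orthogonal j ρ (Word.lt_cons_iff.mp hρ),
      innerProd_monomial_ι_mul_orthoPoly hμ hρ, mul_zero, sub_zero]
  cases τ with
  | cons j ρ => exact hcons j ρ hτ
  | empty =>
    -- `1` is a combination of `R` and monomials of positive degree, and `D` is orthogonal to both.
    obtain ⟨c, hc, hmem⟩ := h.constant_coeff
    have hR : μ.innerProd R D = 0 := by
      rw [hD, innerProd_sub_right, innerProd_smul_right, h.norm_eq_one, coeffWith, conj_innerProd,
        mul_one, sub_self]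
    have hW : μ.innerProd (R - c • 1) D = 0 := by
      refine μ.innerProd_eq_zero_of_mem_polySpan hmem fun ρ hρ => ?_
      cases ρ with
      | empty => exact absurd hρ.1 (lt_irrefl _)
      | cons j ρ => exact hcons j ρ (Word.lt_cons_iff.mpr hρ.2)
    rw [innerProd_sub_left, hR, innerProd_smul_left, zero_sub, neg_eq_zero, mul_eq_zero] at hW
    rw [monomial_empty]
    exact hW.resolve_left hc

/-- One step of the recurrence for the orthonormal polynomials. The norm of
`Z_k φ_σ - γ φ^#_{kσ-1}` is `(1 - |γ|²)^{1/2}`, and it is positive because the leading coefficient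
is. -/
theorem IsReverseAt.orthoPoly_cons (hμ : μ.NonTrivial) {k : Fin d} {σ : Word d} {R : NCPoly d}
    (h : μ.IsReverseAt (Word.predCons k σ) R) :
    ‖μ.coeffWith k σ R‖ < 1 ∧ μ.orthoPoly (Word.cons k σ) =
      ((Real.sqrt (1 - ‖μ.coeffWith k σ R‖ ^ 2) : ℂ)⁻¹) •
        (FreeAlgebra.ι ℂ k * μ.orthoPoly σ - μ.coeffWith k σ R • R) := by
  have hlead : (FreeAlgebra.ι ℂ k * μ.orthoPoly σ - μ.coeffWith k σ R • R) -
      (((μ.normOf (μ.monicPoly σ))⁻¹ : ℝ) : ℂ) • monomial (Word.cons k σ) ∈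
        polySpan (Set.Iio (Word.cons k σ)) := by
    rw [sub_right_comm, Complex.ofReal_inv]
    refine sub_mem (polySpan_mono (image_cons_Iio_subset k σ)
      (μ.ι_mul_orthoPoly_sub_mem k σ)) (Submodule.smul_mem _ _ ?_)
    rw [Iio_cons]
    exact h.mem_polySpan
  obtain ⟨hpos, heq⟩ := orthoPoly_eq_of_orthogonal hμ
    (inv_pos.mpr (normOf_monicPoly_pos hμ σ)) hlead (h.orthogonal_sub hμ)
  have hRA : μ.innerProd R (FreeAlgebra.ι ℂ k * μ.orthoPoly σ) =
      starRingEnd ℂ (μ.coeffWith k σ R) := by rw [coeffWith, conj_innerProd]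
  have hAR : μ.innerProd (FreeAlgebra.ι ℂ k * μ.orthoPoly σ) R = μ.coeffWith k σ R := rfl
  have hnorm : μ.normOf (FreeAlgebra.ι ℂ k * μ.orthoPoly σ - μ.coeffWith k σ R • R) =
      Real.sqrt (1 - ‖μ.coeffWith k σ R‖ ^ 2) := by
    rw [normOf]
    congr 1
    simp only [innerProd_sub_left, innerProd_sub_right, innerProd_smul_left, innerProd_smul_right,
      innerProd_ι_mul_orthoPoly_self hμ, h.norm_eq_one, hRA, hAR, mul_one, sub_self,
      mul_comm (starRingEnd ℂ _), Complex.mul_conj, Complex.normSq_eq_norm_sq]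
    simp [-Complex.ofReal_pow]
  rw [hnorm] at hpos heq
  refine ⟨?_, heq⟩
  have h1 := Real.sqrt_pos.mp hpos
  exact (sq_lt_one_iff₀ (norm_nonneg _)).mp (by linarith)

/-- If `A`, `R` are unit vectors with `⟨A, R⟩ = γ` and `|γ| < 1`, then
`(1 - |γ|²)^{-1/2} (- conj γ A + R)` is a unit vector. -/
theorem innerProd_reverse_self {A R : NCPoly d} (hA : μ.innerProd A A = 1)
    (hR : μ.innerProd R R = 1) (h : ‖μ.innerProd A R‖ < 1) :
    μ.innerProd
      (((Real.sqrt (1 - ‖μ.innerProd A R‖ ^ 2) : ℂ)⁻¹) •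
        (-(starRingEnd ℂ (μ.innerProd A R)) • A + R))
      (((Real.sqrt (1 - ‖μ.innerProd A R‖ ^ 2) : ℂ)⁻¹) •
        (-(starRingEnd ℂ (μ.innerProd A R)) • A + R)) = 1 := by
  have hpos : 0 < 1 - ‖μ.innerProd A R‖ ^ 2 :=
    sub_pos.mpr ((sq_lt_one_iff₀ (norm_nonneg _)).mpr h)
  have hs : (Real.sqrt (1 - ‖μ.innerProd A R‖ ^ 2) : ℂ) ^ 2 =
      1 - μ.innerProd A R * starRingEnd ℂ (μ.innerProd A R) := by
    rw [← Complex.ofReal_pow, Real.sq_sqrt hpos.le, Complex.mul_conj, Complex.normSq_eq_norm_sq]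
    push_cast
    rfl
  have hs0 : (Real.sqrt (1 - ‖μ.innerProd A R‖ ^ 2) : ℂ) ≠ 0 :=
    Complex.ofReal_ne_zero.mpr (Real.sqrt_pos.mpr hpos).ne'
  simp only [innerProd_add_left, innerProd_add_right, innerProd_smul_left, innerProd_smul_right,
    hA, hR, ← μ.conj_innerProd A R, map_neg, map_inv₀, Complex.conj_ofReal, Complex.conj_conj]
  field_simp
  rw [hs]
  ring

theorem IsReverseAt.reverseStep (hμ : μ.NonTrivial) {k : Fin d} {σ : Word d} {R : NCPoly d}
    (h : μ.IsReverseAt (Word.predCons k σ) R) :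
    μ.IsReverseAt (Word.cons k σ) (μ.reverseStep k σ R) := by
  obtain ⟨hlt, -⟩ := h.orthoPoly_cons hμ
  have hs0 : (Real.sqrt (1 - ‖μ.coeffWith k σ R‖ ^ 2) : ℂ)⁻¹ ≠ 0 :=
    inv_ne_zero (Complex.ofReal_ne_zero.mpr (Real.sqrt_pos.mpr
      (sub_pos.mpr ((sq_lt_one_iff₀ (norm_nonneg _)).mpr hlt))).ne')
  have hA := innerProd_ι_mul_orthoPoly_self hμ k σ
  have hearlier : ∀ j τ, Word.cons j τ < Word.cons k σ →
      μ.innerProd (monomial (Word.cons j τ)) (μ.reverseStep k σ R) = 0 := by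
    intro j τ hτ
    rw [NCMeasure.reverseStep, innerProd_smul_right, innerProd_add_right, innerProd_smul_right,
      innerProd_monomial_ι_mul_orthoPoly hμ hτ, h.orthogonal j τ (Word.lt_cons_iff.mp hτ),
      mul_zero, add_zero, mul_zero]
  refine ⟨innerProd_reverse_self hA h.norm_eq_one hlt, ?_, ?_⟩
  · intro j τ hτ
    rcases hτ.lt_or_eq with hτ | hτ
    · exact hearlier j τ hτ
    · -- `Z^{kσ}` is a combination of `Z_k φ_σ` and earlier monomials of positive degree.
      rw [hτ]
      have h1 : μ.innerProd (FreeAlgebra.ι ℂ k * μ.orthoPoly σ) (μ.reverseStep k σ R) = 0 := by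
        rw [NCMeasure.reverseStep, innerProd_smul_right, innerProd_add_right,
          innerProd_smul_right, hA]
        simp [coeffWith]
      have h2 : μ.innerProd (FreeAlgebra.ι ℂ k * μ.orthoPoly σ -
          ((μ.normOf (μ.monicPoly σ) : ℂ)⁻¹) • monomial (Word.cons k σ))
            (μ.reverseStep k σ R) = 0 := by
        refine μ.innerProd_eq_zero_of_mem_polySpan (μ.ι_mul_orthoPoly_sub_mem k σ) ?_
        rintro _ ⟨ρ, hρ, rfl⟩
        exact hearlier k ρ (Word.cons_lt_cons.mpr hρ)
      rw [innerProd_sub_left, h1, innerProd_smul_left, zero_sub, neg_eq_zero, mul_eq_zero] at h2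
      exact h2.resolve_left (inv_ne_zero (Complex.ofReal_ne_zero.mpr
        (normOf_monicPoly_pos hμ σ).ne'))
  · obtain ⟨c, hc, hmem⟩ := h.constant_coeff
    refine ⟨_, mul_ne_zero hs0 hc, ?_⟩
    rw [NCMeasure.reverseStep, mul_smul, ← smul_sub, add_sub_assoc]
    refine Submodule.smul_mem _ _ (add_mem (Submodule.smul_mem _ _ ?_) ?_)
    · refine polySpan_mono ?_ (ι_mul_mem_polySpan k (μ.orthoPoly_mem_polySpan σ))
      rintro _ ⟨τ, hτ, rfl⟩
      exact ⟨Word.empty_lt_cons k τ, Word.cons_le_cons.mpr hτ⟩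
    · exact polySpan_mono (Set.Ioc_subset_Ioc_right (Word.predCons_lt k σ).le) hmem

theorem reversePoly_empty (μ : NCMeasure d) : μ.reversePoly Word.empty = 1 := by
  rw [reversePoly]

theorem reversePoly_cons (μ : NCMeasure d) (k : Fin d) (σ : Word d) :
    μ.reversePoly (Word.cons k σ) =
      μ.reverseStep k σ (μ.reversePoly (Word.predCons k σ)) := by
  rw [reversePoly]

theorem isReverseAt_reversePoly (hμ : μ.NonTrivial) (hμ1 : μ.IsProbability) (σ : Word d) :
    μ.IsReverseAt σ (μ.reversePoly σ) := by
  induction σ using WellFoundedLT.induction with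
  | ind σ ih =>
    cases σ with
    | empty =>
      rw [reversePoly_empty]
      exact isReverseAt_empty hμ1
    | cons k σ =>
      rw [reversePoly_cons]
      exact (ih _ (Word.predCons_lt k σ)).reverseStep hμ

theorem isReverseFamily (hμ : μ.NonTrivial) (hμ1 : μ.IsProbability) :
    μ.IsReverseFamily μ.verblunsky μ.reversePoly where
  coeff_empty := rfl
  norm_lt_one σ := by
    cases σ with
    | empty => simp [verblunsky]
    | cons k σ => exact ((isReverseAt_reversePoly hμ hμ1 _).orthoPoly_cons hμ).1
  reverse_empty := reversePoly_empty μ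
  ortho_cons k σ := ((isReverseAt_reversePoly hμ hμ1 _).orthoPoly_cons hμ).2
  reverse_cons k σ := reversePoly_cons μ k σ

/-- In any solution of the recurrences, `φ_{kσ}` is orthogonal to `φ^#_{kσ-1}`, which forces
`γ_{kσ} = ⟨Z_k φ_σ, φ^#_{kσ-1}⟩` and determines the solution recursively. -/
theorem IsReverseFamily.eq_reversePoly (hμ : μ.NonTrivial) (hμ1 : μ.IsProbability)
    {γ : Word d → ℂ} {ψ : Word d → NCPoly d} (h : μ.IsReverseFamily γ ψ) (σ : Word d) :
    γ σ = μ.verblunsky σ ∧ ψ σ = μ.reversePoly σ := by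
  induction σ using WellFoundedLT.induction with
  | ind σ ih =>
    cases σ with
    | empty => exact ⟨h.coeff_empty, h.reverse_empty.trans (reversePoly_empty μ).symm⟩
    | cons k σ =>
      have hψ := (ih _ (Word.predCons_lt k σ)).2
      have hrev := isReverseAt_reversePoly hμ hμ1 (Word.predCons k σ)
      have horth : μ.innerProd (μ.orthoPoly (Word.cons k σ)) (ψ (Word.predCons k σ)) = 0 := by
        refine μ.innerProd_eq_zero_symm (μ.innerProd_eq_zero_of_mem_polySpan
          (hψ ▸ hrev.mem_polySpan) fun τ hτ => ?_)
        exact innerProd_monomial_orthoPoly hμ (Word.lt_cons_iff.mpr hτ)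
      have hs0 : (Real.sqrt (1 - ‖γ (Word.cons k σ)‖ ^ 2) : ℂ)⁻¹ ≠ 0 :=
        inv_ne_zero (Complex.ofReal_ne_zero.mpr (Real.sqrt_pos.mpr
          (sub_pos.mpr ((sq_lt_one_iff₀ (norm_nonneg _)).mpr (h.norm_lt_one _)))).ne')
      rw [h.ortho_cons, innerProd_smul_left, innerProd_sub_left, innerProd_smul_left, hψ,
        hrev.norm_eq_one, mul_one] at horth
      have hγ : γ (Word.cons k σ) = μ.coeffWith k σ (μ.reversePoly (Word.predCons k σ)) :=
        (sub_eq_zero.mp ((mul_eq_zero.mp horth).resolve_left hs0)).symm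
      refine ⟨hγ, ?_⟩
      rw [h.reverse_cons, reversePoly_cons, NCMeasure.reverseStep, hγ, hψ]

theorem isReverseFamily_iff (hμ : μ.NonTrivial) (hμ1 : μ.IsProbability)
    (γ : Word d → ℂ) (ψ : Word d → NCPoly d) :
    μ.IsReverseFamily γ ψ ↔ γ = μ.verblunsky ∧ ψ = μ.reversePoly := by
  constructor
  · intro h
    exact ⟨funext fun σ => (h.eq_reversePoly hμ hμ1 σ).1,
      funext fun σ => (h.eq_reversePoly hμ hμ1 σ).2⟩
  · rintro ⟨rfl, rfl⟩
    exact isReverseFamily hμ hμ1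

end NCMeasure

/-! ### The Christoffel-Darboux identity -/

section Matrices

open Matrix

variable {m : ℕ}

/-- The recurrence matrix `(1 - |γ|²)^{-1/2} [[1, -γ], [-γ̄, 1]]` preserves the indefinite form
`AᴴA - BᴴB`. -/
theorem sq_sub_sq_of_recurrence (A B : Matrix (Fin m) (Fin m) ℂ) {γ : ℂ} (hγ : ‖γ‖ < 1) :
    (((Real.sqrt (1 - ‖γ‖ ^ 2) : ℂ)⁻¹) • (A - γ • B))ᴴ *
        (((Real.sqrt (1 - ‖γ‖ ^ 2) : ℂ)⁻¹) • (A - γ • B)) -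
      (((Real.sqrt (1 - ‖γ‖ ^ 2) : ℂ)⁻¹) • (-(starRingEnd ℂ γ) • A + B))ᴴ *
        (((Real.sqrt (1 - ‖γ‖ ^ 2) : ℂ)⁻¹) • (-(starRingEnd ℂ γ) • A + B)) =
      Aᴴ * A - Bᴴ * B := by
  have hpos : 0 < 1 - ‖γ‖ ^ 2 := sub_pos.mpr ((sq_lt_one_iff₀ (norm_nonneg _)).mpr hγ)
  have hs : (Real.sqrt (1 - ‖γ‖ ^ 2) : ℂ) ^ 2 = 1 - γ * starRingEnd ℂ γ := by
    rw [← Complex.ofReal_pow, Real.sq_sqrt hpos.le, Complex.mul_conj, Complex.normSq_eq_norm_sq]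
    push_cast
    rfl
  have hs0 : (Real.sqrt (1 - ‖γ‖ ^ 2) : ℂ) ≠ 0 :=
    Complex.ofReal_ne_zero.mpr (Real.sqrt_pos.mpr hpos).ne'
  set s : ℂ := (Real.sqrt (1 - ‖γ‖ ^ 2) : ℂ) with hsdef
  have hstar : star s⁻¹ = s⁻¹ := by
    rw [star_inv₀, hsdef]
    exact congrArg _ (Complex.conj_ofReal _)
  have h1 : s⁻¹ * s⁻¹ * (1 - γ * starRingEnd ℂ γ) = 1 := by
    rw [← hs]
    field_simp
  have hexp : (s⁻¹ • (A - γ • B))ᴴ * (s⁻¹ • (A - γ • B)) -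
      (s⁻¹ • (-(starRingEnd ℂ γ) • A + B))ᴴ * (s⁻¹ • (-(starRingEnd ℂ γ) • A + B)) =
      (s⁻¹ * s⁻¹ * (1 - γ * starRingEnd ℂ γ)) • (Aᴴ * A - Bᴴ * B) := by
    simp only [conjTranspose_smul, conjTranspose_sub, conjTranspose_add, hstar, star_neg,
      smul_mul_assoc, mul_smul_comm, sub_mul, mul_sub, add_mul, mul_add, RCLike.star_def,
      Complex.conj_conj]
    module
  rw [hexp, h1, one_smul]

namespace NCMeasure

variable (μ : NCMeasure d)

/-- The evaluation `P(Z^*)`. -/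
abbrev atStar (Z : Fin d → Matrix (Fin m) (Fin m) ℂ) (P : NCPoly d) : Matrix (Fin m) (Fin m) ℂ :=
  evalAt (fun k => (Z k).conjTranspose) P

variable {μ}

theorem sqAtStar_reversePoly_cons (hμ : μ.NonTrivial) (hμ1 : μ.IsProbability)
    (Z : Fin d → Matrix (Fin m) (Fin m) ℂ) (k : Fin d) (σ : Word d) :
    sqAtStar (μ.reversePoly (Word.cons k σ)) Z =
      sqAtStar (μ.reversePoly (Word.predCons k σ)) Z +
        (sqAtStar (μ.orthoPoly (Word.cons k σ)) Z -
          (atStar Z (μ.orthoPoly σ))ᴴ * (Z k * (Z k)ᴴ) * atStar Z (μ.orthoPoly σ)) := by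
  have hF := isReverseFamily hμ hμ1
  have h := sq_sub_sq_of_recurrence ((Z k)ᴴ * atStar Z (μ.orthoPoly σ))
    (atStar Z (μ.reversePoly (Word.predCons k σ))) (hF.norm_lt_one (Word.cons k σ))
  have h1 : atStar Z (μ.orthoPoly (Word.cons k σ)) = _ := congrArg (atStar Z) (hF.ortho_cons k σ)
  have h2 : atStar Z (μ.reversePoly (Word.cons k σ)) = _ :=
    congrArg (atStar Z) (hF.reverse_cons k σ)
  simp only [atStar, evalAt_smul, evalAt_add, evalAt_sub, evalAt_mul, evalAt_ι] at h1 h2 h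
  rw [← h1, ← h2] at h
  simp only [sqAtStar]
  rw [conjTranspose_mul, conjTranspose_conjTranspose] at h
  simp only [← Matrix.mul_assoc] at h ⊢
  rw [sub_eq_iff_eq_add] at h
  rw [h]
  abel

/-- The contribution of the word `τ` to `φ^#_σ(Z^*)^* φ^#_σ(Z^*)`, for `τ ⪯ σ`. -/
def cdTerm (μ : NCMeasure d) (Z : Fin d → Matrix (Fin m) (Fin m) ℂ) :
    Word d → Matrix (Fin m) (Fin m) ℂ
  | .empty => 1
  | .cons k σ => sqAtStar (μ.orthoPoly (Word.cons k σ)) Z -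
      (atStar Z (μ.orthoPoly σ))ᴴ * (Z k * (Z k)ᴴ) * atStar Z (μ.orthoPoly σ)

theorem sqAtStar_reversePoly (hμ : μ.NonTrivial) (hμ1 : μ.IsProbability)
    (Z : Fin d → Matrix (Fin m) (Fin m) ℂ) (σ : Word d) :
    sqAtStar (μ.reversePoly σ) Z = ∑ τ ∈ Finset.Iic σ, μ.cdTerm Z τ := by
  induction σ using WellFoundedLT.induction with
  | ind σ ih =>
    cases σ with
    | empty =>
      have h : Finset.Iic (Word.empty : Word d) = {Word.empty} := by
        ext τ
        rw [Finset.mem_Iic, Finset.mem_singleton]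
        exact ⟨fun h => le_antisymm h (Word.empty_le τ), fun h => h.le⟩
      rw [h, Finset.sum_singleton, reversePoly_empty]
      simp [sqAtStar, cdTerm]
    | cons k σ =>
      rw [Word.Iic_cons, Finset.sum_insert (by simpa using Word.predCons_lt k σ),
        sqAtStar_reversePoly_cons hμ hμ1, ih _ (Word.predCons_lt k σ), add_comm]
      rfl

theorem sqAtStar_reversePoly_final_succ [NeZero d] (hμ : μ.NonTrivial) (hμ1 : μ.IsProbability)
    (Z : Fin d → Matrix (Fin m) (Fin m) ℂ) (n : ℕ) :
    sqAtStar (μ.reversePoly (Word.final d (n + 1))) Z =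
      sqAtStar (μ.reversePoly (Word.final d n)) Z +
        (∑ σ ∈ Word.ofLength d (n + 1), sqAtStar (μ.orthoPoly σ) Z -
          ∑ ρ ∈ Word.ofLength d n,
            (atStar Z (μ.orthoPoly ρ))ᴴ * rowGram Z * atStar Z (μ.orthoPoly ρ)) := by
  rw [sqAtStar_reversePoly hμ hμ1, sqAtStar_reversePoly hμ hμ1, Word.Iic_final_succ,
    Finset.sum_union (Word.disjoint_Iic_final_ofLength n), Word.sum_ofLength_succ,
    Word.sum_ofLength_succ, ← Finset.sum_sub_distrib]
  congr 1
  refine Finset.sum_congr rfl fun ρ _ => ?_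
  simp only [cdTerm, Finset.sum_sub_distrib, rowGram, Finset.mul_sum, Finset.sum_mul]

/-- The Christoffel-Darboux identity. -/
theorem christoffel_darboux [NeZero d] (hμ : μ.NonTrivial) (hμ1 : μ.IsProbability)
    (Z : Fin d → Matrix (Fin m) (Fin m) ℂ) (n : ℕ) :
    sqAtStar (μ.reversePoly (Word.final d n)) Z =
      ∑ σ ∈ Word.ofLength d n, sqAtStar (μ.orthoPoly σ) Z +
        ∑ j ∈ Finset.range n, ∑ ρ ∈ Word.ofLength d j,
          (atStar Z (μ.orthoPoly ρ))ᴴ * (1 - rowGram Z) * atStar Z (μ.orthoPoly ρ) := by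
  induction n with
  | zero =>
    rw [Word.ofLength_zero, Finset.sum_singleton, Finset.sum_range_zero, add_zero,
      orthoPoly_empty μ hμ1]
    exact congrArg (sqAtStar · Z) (reversePoly_empty μ)
  | succ n ih =>
    rw [sqAtStar_reversePoly_final_succ hμ hμ1, ih, Finset.sum_range_succ]
    simp only [mul_sub, sub_mul, mul_one, Finset.sum_sub_distrib, sqAtStar]
    abel

/-! ### Nonsingularity -/

theorem posSemidef_sum_sqAtStar (Z : Fin d → Matrix (Fin m) (Fin m) ℂ) (s : Finset (Word d)) :
    (∑ σ ∈ s, sqAtStar (μ.orthoPoly σ) Z).PosSemidef :=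
  posSemidef_sum _ fun _ _ => posSemidef_conjTranspose_mul_self _

/-- The empty word contributes `C` itself to the sum. -/
theorem posDef_sum_conjugate (hμ1 : μ.IsProbability) (Z : Fin d → Matrix (Fin m) (Fin m) ℂ)
    {C : Matrix (Fin m) (Fin m) ℂ} (hC : C.PosDef) (n : ℕ) :
    (∑ j ∈ Finset.range (n + 1), ∑ ρ ∈ Word.ofLength d j,
      (atStar Z (μ.orthoPoly ρ))ᴴ * C * atStar Z (μ.orthoPoly ρ)).PosDef := by
  rw [Finset.sum_range_succ', Word.ofLength_zero, Finset.sum_singleton, orthoPoly_empty μ hμ1,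
    atStar, evalAt_one, conjTranspose_one, one_mul, mul_one]
  exact PosDef.posSemidef_add (posSemidef_sum _ fun _ _ => posSemidef_sum _ fun _ _ =>
    hC.posSemidef.conjTranspose_mul_mul_same _) hC

theorem sum_ofLength_zero_sqAtStar (hμ1 : μ.IsProbability)
    (Z : Fin d → Matrix (Fin m) (Fin m) ℂ) :
    ∑ σ ∈ Word.ofLength d 0, sqAtStar (μ.orthoPoly σ) Z = 1 := by
  rw [Word.ofLength_zero, Finset.sum_singleton, orthoPoly_empty μ hμ1]
  simp [sqAtStar]

theorem posDef_sqAtStar_reversePoly_final [NeZero d] (hμ : μ.NonTrivial) (hμ1 : μ.IsProbability)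
    {Z : Fin d → Matrix (Fin m) (Fin m) ℂ} (hZ : InRowBall Z) (n : ℕ) :
    (sqAtStar (μ.reversePoly (Word.final d n)) Z).PosDef := by
  rw [christoffel_darboux hμ hμ1]
  cases n with
  | zero =>
    rw [sum_ofLength_zero_sqAtStar hμ1, Finset.sum_range_zero, add_zero]
    exact PosDef.one
  | succ n =>
    exact PosDef.posSemidef_add (posSemidef_sum_sqAtStar Z _) (posDef_sum_conjugate hμ1 Z hZ n)

theorem posDef_sum_sqAtStar_orthoPoly [NeZero d] (hμ : μ.NonTrivial) (hμ1 : μ.IsProbability)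
    {Z : Fin d → Matrix (Fin m) (Fin m) ℂ} (hZ : InExterior Z) (n : ℕ) :
    (∑ σ ∈ Word.ofLength d n, sqAtStar (μ.orthoPoly σ) Z).PosDef := by
  cases n with
  | zero =>
    rw [sum_ofLength_zero_sqAtStar hμ1]
    exact PosDef.one
  | succ n =>
    have h := christoffel_darboux hμ hμ1 Z (n + 1)
    rw [← neg_sub (rowGram Z) 1] at h
    simp only [mul_neg, neg_mul, Finset.sum_neg_distrib] at h
    rw [← sub_eq_add_neg, eq_comm, sub_eq_iff_eq_add] at h
    rw [h]
    exact PosDef.posSemidef_add (posSemidef_conjTranspose_mul_self _)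
      (posDef_sum_conjugate hμ1 Z hZ n)

/-- The recurrence, solved for the polynomials of lower index. -/
theorem mulVec_eq_zero_of_cons (hμ : μ.NonTrivial) (hμ1 : μ.IsProbability)
    {Z : Fin d → Matrix (Fin m) (Fin m) ℂ} {v : Fin m → ℂ} {k : Fin d} {σ : Word d}
    (h1 : atStar Z (μ.orthoPoly (Word.cons k σ)) *ᵥ v = 0)
    (h2 : atStar Z (μ.reversePoly (Word.cons k σ)) *ᵥ v = 0) :
    (Z k)ᴴ *ᵥ (atStar Z (μ.orthoPoly σ) *ᵥ v) = 0 ∧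
      atStar Z (μ.reversePoly (Word.predCons k σ)) *ᵥ v = 0 := by
  have hF := isReverseFamily hμ hμ1
  have hpos : 0 < 1 - ‖μ.verblunsky (Word.cons k σ)‖ ^ 2 :=
    sub_pos.mpr ((sq_lt_one_iff₀ (norm_nonneg _)).mpr (hF.norm_lt_one _))
  have hs0 : (Real.sqrt (1 - ‖μ.verblunsky (Word.cons k σ)‖ ^ 2) : ℂ)⁻¹ ≠ 0 :=
    inv_ne_zero (Complex.ofReal_ne_zero.mpr (Real.sqrt_pos.mpr hpos).ne')
  rw [hF.ortho_cons, atStar, evalAt_smul, smul_mulVec,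
    smul_eq_zero_iff_right hs0, evalAt_sub, sub_mulVec, evalAt_smul, smul_mulVec, evalAt_mul,
    evalAt_ι, ← mulVec_mulVec] at h1
  rw [hF.reverse_cons, atStar, evalAt_smul, smul_mulVec,
    smul_eq_zero_iff_right hs0, evalAt_add, add_mulVec, evalAt_smul, smul_mulVec, evalAt_mul,
    evalAt_ι, ← mulVec_mulVec] at h2
  have h3 : atStar Z (μ.reversePoly (Word.predCons k σ)) *ᵥ v = 0 := by
    have hdet : (1 : ℂ) - μ.verblunsky (Word.cons k σ) *
        starRingEnd ℂ (μ.verblunsky (Word.cons k σ)) ≠ 0 := by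
      rw [Complex.mul_conj, Complex.normSq_eq_norm_sq]
      exact_mod_cast hpos.ne'
    have h4 : ((1 : ℂ) - μ.verblunsky (Word.cons k σ) *
        starRingEnd ℂ (μ.verblunsky (Word.cons k σ))) •
          (atStar Z (μ.reversePoly (Word.predCons k σ)) *ᵥ v) = 0 := by
      have h5 := congrArg₂ (· + ·) h2
        (congrArg (starRingEnd ℂ (μ.verblunsky (Word.cons k σ)) • ·) h1)
      simp only [smul_zero, add_zero] at h5
      rw [← h5]
      module
    exact (smul_eq_zero_iff_right hdet).mp h4
  rw [h3, smul_zero, sub_zero] at h1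
  exact ⟨h1, h3⟩

/-- Descent from the words of length `n + 1` to the final word of length `n`. -/
theorem mulVec_eq_zero_of_final_le [NeZero d] (hμ : μ.NonTrivial) (hμ1 : μ.IsProbability)
    {Z : Fin d → Matrix (Fin m) (Fin m) ℂ} {v : Fin m → ℂ} {n : ℕ}
    (hv : ∀ τ ∈ Word.ofLength d (n + 1), atStar Z (μ.orthoPoly τ) *ᵥ v = 0) (σ : Word d)
    (h1 : Word.final d n ≤ σ) (h2 : σ ≤ Word.final d (n + 1))
    (hσ : atStar Z (μ.reversePoly σ) *ᵥ v = 0) :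
    atStar Z (μ.reversePoly (Word.final d n)) *ᵥ v = 0 ∧
      ∀ k ρ, ρ ∈ Word.ofLength d n → Word.cons k ρ ≤ σ →
        (Z k)ᴴ *ᵥ (atStar Z (μ.orthoPoly ρ) *ᵥ v) = 0 := by
  induction σ using WellFoundedLT.induction with
  | ind σ ih =>
    rcases h1.eq_or_lt with rfl | h1
    · refine ⟨hσ, fun k ρ hρ hle => ?_⟩
      have := Word.le_final_iff.mp hle
      rw [Word.length_cons, Word.mem_ofLength.mp hρ] at this
      omega
    · cases σ with
      | empty => exact absurd h1 (Word.empty_le _).not_gt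
      | cons k σ =>
        have hlen : Word.cons k σ ∈ Word.ofLength d (n + 1) := by
          rw [← not_le, Word.le_final_iff] at h1
          rw [Word.le_final_iff] at h2
          rw [Word.mem_ofLength]
          omega
        obtain ⟨h3, h4⟩ := mulVec_eq_zero_of_cons hμ hμ1 (hv _ hlen) hσ
        have hlt := Word.predCons_lt k σ
        obtain ⟨h5, h6⟩ := ih _ hlt (Word.lt_cons_iff.mp h1) (hlt.le.trans h2) h4
        refine ⟨h5, fun j ρ hρ hle => ?_⟩
        rcases hle.eq_or_lt with heq | hlt'
        · obtain ⟨rfl, rfl⟩ := Word.cons.inj heq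
          exact h3
        · exact h6 j ρ hρ (Word.lt_cons_iff.mp hlt')

/-- A common null vector at level `n` descends to level `0`, where `φ_∅ = 1`: the recurrence gives
`Z_k^* φ_ρ(Z^*) v = 0` for all `k` and `|ρ| = n - 1`, and `Z` is a row co-isometry. -/
theorem eq_zero_of_mulVec_eq_zero [NeZero d] (hμ : μ.NonTrivial) (hμ1 : μ.IsProbability)
    {Z : Fin d → Matrix (Fin m) (Fin m) ℂ} (hZ : IsRowCoisometry Z) {v : Fin m → ℂ} (n : ℕ)
    (hψ : atStar Z (μ.reversePoly (Word.final d n)) *ᵥ v = 0)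
    (hφ : ∀ τ ∈ Word.ofLength d n, atStar Z (μ.orthoPoly τ) *ᵥ v = 0) : v = 0 := by
  induction n with
  | zero =>
    have h := hφ Word.empty (by simp [Word.mem_ofLength])
    rwa [orthoPoly_empty μ hμ1, atStar, evalAt_one, one_mulVec] at h
  | succ n ih =>
    obtain ⟨h1, h2⟩ := mulVec_eq_zero_of_final_le hμ hμ1 hφ (Word.final d (n + 1))
      (Word.le_final_iff.mpr ((Word.length_final n).le.trans n.le_succ)) le_rfl hψ
    refine ih h1 fun ρ hρ => ?_
    rw [← one_mulVec (atStar Z (μ.orthoPoly ρ) *ᵥ v), ← show rowGram Z = 1 from hZ, rowGram,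
      sum_mulVec]
    refine Finset.sum_eq_zero fun k _ => ?_
    rw [← mulVec_mulVec, h2 k ρ hρ, mulVec_zero]
    rw [Word.le_final_iff, Word.length_cons, Word.mem_ofLength.mp hρ]

theorem sqAtStar_reversePoly_final_of_isRowCoisometry [NeZero d] (hμ : μ.NonTrivial)
    (hμ1 : μ.IsProbability) {Z : Fin d → Matrix (Fin m) (Fin m) ℂ} (hZ : IsRowCoisometry Z)
    (n : ℕ) :
    sqAtStar (μ.reversePoly (Word.final d n)) Z =
      ∑ σ ∈ Word.ofLength d n, sqAtStar (μ.orthoPoly σ) Z := by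
  rw [christoffel_darboux hμ hμ1, show rowGram Z = 1 from hZ]
  simp

theorem det_sqAtStar_reversePoly_final_ne_zero [NeZero d] (hμ : μ.NonTrivial)
    (hμ1 : μ.IsProbability) {Z : Fin d → Matrix (Fin m) (Fin m) ℂ} (hZ : IsRowCoisometry Z)
    (n : ℕ) :
    (sqAtStar (μ.reversePoly (Word.final d n)) Z).det ≠ 0 := by
  intro hdet
  obtain ⟨v, hv0, hv⟩ := exists_mulVec_eq_zero_iff.mpr hdet
  refine hv0 (eq_zero_of_mulVec_eq_zero hμ hμ1 hZ n
    ((conjTranspose_mul_self_mulVec_eq_zero _ _).mp hv) ?_)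
  rw [sqAtStar_reversePoly_final_of_isRowCoisometry hμ hμ1 hZ, sum_mulVec] at hv
  have hsum := congrArg (star v ⬝ᵥ ·) hv
  simp only [dotProduct_sum, dotProduct_zero] at hsum
  intro τ hτ
  have h := (Finset.sum_eq_zero_iff_of_nonneg fun σ _ =>
    (posSemidef_conjTranspose_mul_self (atStar Z (μ.orthoPoly σ))).dotProduct_mulVec_nonneg v).mp
      hsum τ hτ
  have h' := ((posSemidef_conjTranspose_mul_self
    (atStar Z (μ.orthoPoly τ))).dotProduct_mulVec_zero_iff v).mp h
  exact (conjTranspose_mul_self_mulVec_eq_zero _ _).mp h'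

end NCMeasure
end Matrices
end NCZeros

end

theorem mainTheorem4 (d : ℕ) [NeZero d] (μ : NCZeros.NCMeasure d)
    (hμ : μ.NonTrivial) (hμ1 : μ.IsProbability) :
    (∀ (γ : NCZeros.Word d → ℂ) (ψ : NCZeros.Word d → NCZeros.NCPoly d),
      μ.IsReverseFamily γ ψ ↔ γ = μ.verblunsky ∧ ψ = μ.reversePoly) ∧
    ∀ (n m : ℕ) (Z : Fin d → Matrix (Fin m) (Fin m) ℂ),
      (NCZeros.InRowBall Z →
        (NCZeros.sqAtStar (μ.reversePoly (NCZeros.Word.final d n)) Z).det ≠ 0) ∧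
      (NCZeros.InExterior Z →
        (∑ σ ∈ NCZeros.Word.ofLength d n, NCZeros.sqAtStar (μ.orthoPoly σ) Z).det ≠ 0) ∧
      (NCZeros.IsRowCoisometry Z →
        (NCZeros.sqAtStar (μ.reversePoly (NCZeros.Word.final d n)) Z).det ≠ 0 ∧
        (∑ σ ∈ NCZeros.Word.ofLength d n, NCZeros.sqAtStar (μ.orthoPoly σ) Z).det ≠ 0 ∧
        NCZeros.sqAtStar (μ.reversePoly (NCZeros.Word.final d n)) Z =
          ∑ σ ∈ NCZeros.Word.ofLength d n, NCZeros.sqAtStar (μ.orthoPoly σ) Z) := by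
  refine ⟨NCZeros.NCMeasure.isReverseFamily_iff hμ hμ1, fun n m Z => ⟨fun hZ => ?_, fun hZ => ?_,
    fun hZ => ?_⟩⟩
  · exact (NCZeros.NCMeasure.posDef_sqAtStar_reversePoly_final hμ hμ1 hZ n).det_pos.ne'
  · exact (NCZeros.NCMeasure.posDef_sum_sqAtStar_orthoPoly hμ hμ1 hZ n).det_pos.ne'
  · have h := NCZeros.NCMeasure.det_sqAtStar_reversePoly_final_ne_zero hμ hμ1 hZ n
    have heq := NCZeros.NCMeasure.sqAtStar_reversePoly_final_of_isRowCoisometry hμ hμ1 hZ n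
    exact ⟨h, heq ▸ h, heq⟩
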